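/- Let $A$ be a finite alphabet and let $x=x_0x_1x_2\cdots\in A^{\mathbb N}$ be an infinite word over $A$. We say that $x$ is ultimately periodic if $x=uvvv\cdots$ for some nonempty finite words $u,v$, and aperiodic otherwise. A border of a finite word $w$ is a nonempty word $u$, shorter than $w$, that is both a prefix and a suffix of $w$. A nonempty finite word $w$ is closed if it has length $1$ or has a border that occurs in $w$ precisely twice; otherwise $w$ is open. Let $\mathrm{cl}_x(n)$ (respectively $\mathrm{op}_x(n)$) be the number of distinct closed (respectively open) words of length $n$ that occur as factors (blocks of consecutive letters) of $x$. A set $S\subseteq\mathbb N$ is syndetic if there is an integer $d\ge 1$ such that $S\cap\{n,n+1,\dots,n+d\}\neq\emptyset$ for every $n\in\mathbb N$. Then the following are equivalent: 1. $x$ is aperiodic; 2. $\liminf_{n\to\infty}\mathrm{op}_x(n)=+\infty$; 3. $\limsup_{n\to\infty}\mathrm{cl}_x(n)=+\infty$; 4. for every syndetic set $S\subseteq\mathbb N$, $\limsup_{n\to\infty,\ n\in S}\mathrm{cl}_x(n)=+\infty$. -/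

import Mathlib

namespace InfWord

/-- The infinite word `u y` obtained by writing the finite word `u` in front of `y`. -/
def prepend {A : Type*} (u : List A) (y : ℕ → A) : ℕ → A :=
  fun i => if h : i < u.length then u[i] else y (i - u.length)

/-- The infinite power `v v v ⋯` of a nonempty finite word `v`. -/
def infPow {A : Type*} (v : List A) (hv : v ≠ []) : ℕ → A :=
  fun i => v[i % v.length]'(Nat.mod_lt i (List.length_pos_of_ne_nil hv))

/-- `x = u v v v ⋯` for some nonempty finite words `u` and `v`. -/
def UltimatelyPeriodic {A : Type*} (x : ℕ → A) : Prop :=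
  ∃ u v : List A, u ≠ [] ∧ ∃ hv : v ≠ [], x = prepend u (infPow v hv)

/-- An infinite word is aperiodic if it is not ultimately periodic. -/
def Aperiodic {A : Type*} (x : ℕ → A) : Prop :=
  ¬ UltimatelyPeriodic x

/-- The finite word `w` occurs in the infinite word `x` at some position `m`. -/
def IsFactor {A : Type*} (w : List A) (x : ℕ → A) : Prop :=
  ∃ m : ℕ, ∀ (i : ℕ) (hi : i < w.length), w[i] = x (m + i)

/-- The set of positions at which the finite word `u` occurs in the finite word `w`. -/
def occurrences {A : Type*} (u w : List A) : Set ℕ :=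
  {m | ∃ p s : List A, w = p ++ u ++ s ∧ p.length = m}

/-- `u` is a border of `w`: a nonempty word, shorter than `w`, that is both a prefix and a
suffix of `w`. -/
def IsBorder {A : Type*} (u w : List A) : Prop :=
  u ≠ [] ∧ u.length < w.length ∧ u <+: w ∧ u <:+ w

/-- A closed word is a letter or a word with a border that occurs in it precisely twice. -/
def ClosedWord {A : Type*} (w : List A) : Prop :=
  w.length = 1 ∨ ∃ u : List A, IsBorder u w ∧ (occurrences u w).encard = 2

/-- An open word is a nonempty word that is not closed. -/
def OpenWord {A : Type*} (w : List A) : Prop :=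
  w ≠ [] ∧ ¬ ClosedWord w

/-- The number of closed factors of `x` of length `n`. -/
noncomputable def closedComplexity {A : Type*} (x : ℕ → A) (n : ℕ) : ℕ∞ :=
  {w : List A | w.length = n ∧ IsFactor w x ∧ ClosedWord w}.encard

/-- The number of open factors of `x` of length `n`. -/
noncomputable def openComplexity {A : Type*} (x : ℕ → A) (n : ℕ) : ℕ∞ :=
  {w : List A | w.length = n ∧ IsFactor w x ∧ OpenWord w}.encard

/-- A set of natural numbers is syndetic if, for some positive `d`, it meets every interval
`{n, …, n + d}`. -/
def Syndetic (S : Set ℕ) : Prop :=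
  ∃ d : ℕ, 0 < d ∧ ∀ n : ℕ, (S ∩ Set.Icc n (n + d)).Nonempty

end InfWord

namespace InfWord

/-! A closed word of length `n > 1` is a first return: its border of length `b` recurs after `q = n
- b` letters and not before. An ultimately periodic word has boundedly many factors of each length,
so 2 and 3 both imply 1.

For 1 → 2, if some period has arbitrarily long runs, windows straddling the end of a run are open
(`le_openComplexity_of_long_periods`). Otherwise few open factors force closed windows at bounded
gaps; a long border would keep its return distance forever and make `x` periodic, and short borders
recur too soon by pigeonhole (`lt_openComplexity_of_no_long_period`).

For 1 → 4, a return whose two occurrences agree on `D` further letters on both sides can be slid and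
lengthened, giving many closed words of every length in an interval
(`le_closedComplexity_of_isReturn`). Such wide returns always exist (`hasWideReturn_of_aperiodic`).
Consider the positions where `x` locally has no period up to `D`; away from them agreement extends
by itself. If they form bounded clusters, a return between two maximal clusters is wide. Otherwise
they have positive density along suitable intervals. A growing set of words of length `D` can change
only boundedly often; applied to left contexts and then to right contexts over many scales, this
yields a wide return. -/

/-- The factors of length `n` of `x` at positions `i` and `j` are equal. -/
def Agree {A : Type*} (x : ℕ → A) (i j n : ℕ) : Prop :=
  ∀ t, t < n → x (i + t) = x (j + t)

/-- The next occurrence of the factor of length `b` at position `m` is at position `m + q`. -/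
def IsReturn {A : Type*} (x : ℕ → A) (m q b : ℕ) : Prop :=
  0 < q ∧ Agree x m (m + q) b ∧ ∀ k, 0 < k → k < q → ¬ Agree x m (m + k) b

/-- The factor of length `n` of `x` at position `m`. -/
def window {A : Type*} (x : ℕ → A) (m n : ℕ) : List A :=
  List.ofFn fun t : Fin n => x (m + t)

/-! ### Windows, and closed words as first returns. -/

variable {A : Type*} {x : ℕ → A}

theorem Agree.symm {i j n : ℕ} (h : Agree x i j n) : Agree x j i n :=
  fun t ht => (h t ht).symm

theorem Agree.trans {i j k n : ℕ} (h : Agree x i j n) (h' : Agree x j k n) : Agree x i k n :=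
  fun t ht => (h t ht).trans (h' t ht)

theorem Agree.mono {i j n n' : ℕ} (h : Agree x i j n) (hn : n' ≤ n) : Agree x i j n' :=
  fun t ht => h t (lt_of_lt_of_le ht hn)

theorem Agree.shift {i j n : ℕ} (h : Agree x i j n) {i' j' n' : ℕ} (s : ℕ) (hi : i' = i + s)
    (hj : j' = j + s) (hn : s + n' ≤ n) : Agree x i' j' n' := by
  intro t ht
  have := h (s + t) (by omega)
  rw [hi, hj, add_assoc, add_assoc]
  exact this

theorem Agree.apply {i j n : ℕ} (h : Agree x i j n) {a c : ℕ} (h1 : i ≤ a) (h2 : a < i + n)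
    (h3 : a + j = c + i) : x a = x c := by
  have := h (a - i) (by omega)
  rwa [show i + (a - i) = a by omega, show j + (a - i) = c by omega] at this

@[simp] theorem length_window (m n : ℕ) : (window x m n).length = n := by
  simp [window]

theorem getElem_window {m n i : ℕ} (hi : i < (window x m n).length) :
    (window x m n)[i] = x (m + i) := by
  simp [window]

theorem window_add (m a b : ℕ) : window x m (a + b) = window x m a ++ window x (m + a) b := by
  apply List.ext_getElem
  · simp
  · intro i h1 h2
    rw [getElem_window]
    by_cases h : i < a
    · rw [List.getElem_append_left (by simpa using h), getElem_window]
    · rw [List.getElem_append_right (by simpa using h), getElem_window]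
      simp only [length_window]
      congr 1
      omega

theorem window_eq_window_iff {i j n : ℕ} : window x i n = window x j n ↔ Agree x i j n := by
  constructor
  · intro h t ht
    have h1 : (window x i n)[t]'(by simpa using ht) = (window x j n)[t]'(by simpa using ht) := by
      simp only [h]
    simpa [getElem_window] using h1
  · intro h
    apply List.ext_getElem
    · simp
    · intro t h1 h2
      rw [getElem_window, getElem_window]
      exact h t (by simpa using h1)

theorem isFactor_iff {w : List A} : IsFactor w x ↔ ∃ m, w = window x m w.length := by
  constructor
  · rintro ⟨m, hm⟩
    refine ⟨m, List.ext_getElem (by simp) fun i h1 h2 => ?_⟩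
    rw [getElem_window, hm]
  · rintro ⟨m, hm⟩
    refine ⟨m, fun i hi => ?_⟩
    have h1 : i < (window x m w.length).length := by simpa using hi
    rw [← getElem_window (x := x) h1]
    simp only [← hm]

theorem isFactor_window (m n : ℕ) : IsFactor (window x m n) x :=
  ⟨m, fun _ hi => getElem_window hi⟩

theorem setOf_factor_eq (n : ℕ) (P : List A → Prop) :
    {w : List A | w.length = n ∧ IsFactor w x ∧ P w} = {w | ∃ m, w = window x m n ∧ P w} := by
  ext w
  simp only [Set.mem_ofPred_eq, isFactor_iff]
  constructor
  · rintro ⟨rfl, ⟨m, hm⟩, h⟩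
    exact ⟨m, hm, h⟩
  · rintro ⟨m, rfl, h⟩
    exact ⟨by simp, ⟨m, by simp⟩, h⟩

theorem window_prefix_eq {u : List A} {m n : ℕ} (h : u <+: window x m n) :
    u = window x m u.length := by
  obtain ⟨s, hs⟩ := h
  refine List.ext_getElem (by simp) fun i h1 h2 => ?_
  have h3 : (u ++ s)[i]'(by simp; omega) = u[i] := List.getElem_append_left h1
  rw [getElem_window, ← h3]
  simp only [hs, getElem_window]

theorem mem_occurrences_window {m n b j o : ℕ} :
    o ∈ occurrences (window x j b) (window x m n) ↔ o + b ≤ n ∧ Agree x j (m + o) b := by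
  constructor
  · rintro ⟨p, s, h, rfl⟩
    have hl := congrArg List.length h
    simp only [length_window, List.length_append] at hl
    refine ⟨by omega, ?_⟩
    rw [← window_eq_window_iff]
    have h1 : window x m n = (window x m p.length ++ window x (m + p.length) b) ++
        window x (m + (p.length + b)) s.length := by
      rw [← window_add, ← window_add, hl]
    rw [h1] at h
    have h2 := List.append_inj_left h (by simp)
    exact (List.append_inj_right h2 (by simp)).symm
  · rintro ⟨h1, h2⟩
    refine ⟨window x m o, window x (m + (o + b)) (n - (o + b)), ?_, by simp⟩
    rw [window_eq_window_iff.2 h2, ← window_add, ← window_add]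
    congr 1
    omega

theorem closedWord_window_iff {m n : ℕ} :
    ClosedWord (window x m n) ↔ n = 1 ∨ ∃ q b, 0 < b ∧ q + b = n ∧ IsReturn x m q b := by
  unfold ClosedWord
  rw [length_window]
  refine or_congr Iff.rfl ⟨?_, ?_⟩
  · rintro ⟨u, ⟨h0, hlt, hp, hs⟩, hocc⟩
    rw [length_window] at hlt
    have hb : 0 < u.length := List.length_pos_of_ne_nil h0
    generalize hbu : u.length = b at *
    have hu : u = window x m b := by rw [← hbu]; exact window_prefix_eq hp
    refine ⟨n - b, b, hb, by omega, by omega, ?_, ?_⟩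
    · obtain ⟨p, hp⟩ := hs
      have hpl := congrArg List.length hp
      simp only [length_window, List.length_append] at hpl
      have : p.length ∈ occurrences (window x m b) (window x m n) :=
        ⟨p, [], by rw [← hp, hu]; simp, rfl⟩
      have := (mem_occurrences_window.1 this).2
      rwa [show p.length = n - b by omega] at this
    · intro k hk hkq hag
      have h0 : 0 ∈ occurrences u (window x m n) := by
        rw [hu, mem_occurrences_window]
        exact ⟨by omega, fun _ _ => rfl⟩
      have hk' : k ∈ occurrences u (window x m n) := by
        rw [hu, mem_occurrences_window]
        exact ⟨by omega, hag⟩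
      have hq : n - b ∈ occurrences u (window x m n) := by
        obtain ⟨p, hp⟩ := hs
        have hpl := congrArg List.length hp
        simp only [length_window, List.length_append] at hpl
        exact ⟨p, [], by rw [← hp]; simp, by omega⟩
      have h3 : ({0, k, n - b} : Set ℕ) ⊆ occurrences u (window x m n) := by
        rintro y (rfl | rfl | rfl) <;> assumption
      have h4 := Set.encard_le_encard h3
      rw [hocc, Set.encard_eq_three.2 ⟨0, k, n - b, by omega, by omega, by omega, rfl⟩] at h4
      exact absurd h4 (by decide)
  · rintro ⟨q, b, hb, rfl, hq, hag, hmin⟩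
    refine ⟨window x m b, ⟨?_, by simpa using hq, ?_, ?_⟩, ?_⟩
    · intro h
      have := congrArg List.length h
      simp at this
      omega
    · rw [add_comm, window_add]
      exact List.prefix_append _ _
    · rw [window_eq_window_iff.2 hag, window_add]
      exact List.suffix_append _ _
    · rw [Set.encard_eq_two]
      refine ⟨0, q, by omega, ?_⟩
      ext o
      rw [mem_occurrences_window]
      simp only [Set.mem_insert_iff, Set.mem_singleton_iff]
      constructor
      · rintro ⟨h1, h2⟩
        by_contra hcon
        exact hmin o (by omega) (by omega) h2
      · rintro (rfl | rfl)
        · exact ⟨by omega, fun _ _ => rfl⟩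
        · exact ⟨le_rfl, hag⟩

/-! ### Ultimate periodicity and counting of factors. -/

theorem ultimatelyPeriodic_of_forall {q N : ℕ} (hq : 0 < q)
    (h : ∀ y, N ≤ y → x (y + q) = x y) : UltimatelyPeriodic x := by
  have hv : window x (N + 1) q ≠ [] := by
    intro h
    have := congrArg List.length h
    simp at this
    omega
  have hu : window x 0 (N + 1) ≠ [] := by
    intro h
    have := congrArg List.length h
    simp at this
  have hper : ∀ k y, N ≤ y → x (y + q * k) = x y := by
    intro k
    induction k with
    | zero => intro y _; simp
    | succ k ih =>
      intro y hy
      rw [Nat.mul_succ, ← add_assoc, h _ (by omega), ih y hy]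
  refine ⟨_, _, hu, hv, ?_⟩
  funext i
  unfold prepend infPow
  split_ifs with hi
  · rw [getElem_window]
    simp
  · rw [getElem_window]
    simp only [length_window] at hi ⊢
    have hdiv := Nat.mod_add_div (i - (N + 1)) q
    rw [← hper ((i - (N + 1)) / q) (N + 1 + (i - (N + 1)) % q) (by omega), add_assoc,
      hdiv]
    congr 1
    omega

theorem exists_eventually_periodic (h : UltimatelyPeriodic x) :
    ∃ q N, 0 < q ∧ ∀ y, N ≤ y → x (y + q) = x y := by
  obtain ⟨u, v, -, hv, rfl⟩ := h
  refine ⟨v.length, u.length, List.length_pos_of_ne_nil hv, fun y hy => ?_⟩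
  unfold prepend infPow
  rw [dif_neg (by omega), dif_neg (by omega)]
  simp only [show y + v.length - u.length = y - u.length + v.length by omega,
    Nat.add_mod_right]

theorem encard_factor_le (h : UltimatelyPeriodic x) :
    ∃ C : ℕ, ∀ (n : ℕ) (P : List A → Prop),
      {w : List A | w.length = n ∧ IsFactor w x ∧ P w}.encard ≤ C := by
  obtain ⟨q, N, hq, hper⟩ := exists_eventually_periodic h
  refine ⟨N + q, fun n P => ?_⟩
  have key : ∀ m, ∃ m' < N + q, window x m n = window x m' n := by
    intro m
    induction m using Nat.strong_induction_on with
    | _ m ih =>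
      by_cases hm : m < N + q
      · exact ⟨m, hm, rfl⟩
      · obtain ⟨m', h1, h2⟩ := ih (m - q) (by omega)
        refine ⟨m', h1, Eq.trans ?_ h2⟩
        rw [window_eq_window_iff]
        intro t ht
        rw [← hper (m - q + t) (by omega)]
        congr 1
        omega
  rw [setOf_factor_eq]
  have hsub : {w | ∃ m, w = window x m n ∧ P w} ⊆
      (fun m => window x m n) '' (Finset.range (N + q) : Set ℕ) := by
    rintro _ ⟨m, rfl, -⟩
    obtain ⟨m', h1, h2⟩ := key m
    exact ⟨m', by simpa using h1, h2.symm⟩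
  refine (Set.encard_le_encard hsub).trans ((Set.encard_image_le _ _).trans ?_)
  rw [Set.encard_coe_eq_coe_finsetCard, Finset.card_range]

theorem le_encard_factor {n K : ℕ} {P : List A → Prop} (s : ℕ → ℕ)
    (hP : ∀ k < K, P (window x (s k) n))
    (hne : ∀ k k', k < k' → k' < K → ¬ Agree x (s k) (s k') n) :
    (K : ℕ∞) ≤ {w : List A | w.length = n ∧ IsFactor w x ∧ P w}.encard := by
  have hinj : Set.InjOn (fun k => window x (s k) n) (Finset.range K : Set ℕ) := by
    intro k hk k' hk' h
    simp only [Finset.coe_range, Set.mem_Iio] at hk hk'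
    rcases lt_trichotomy k k' with hlt | heq | hlt
    · exact absurd (window_eq_window_iff.1 h) (hne _ _ hlt hk')
    · exact heq
    · exact absurd (window_eq_window_iff.1 h.symm) (hne _ _ hlt hk)
  rw [← Finset.card_range K, ← Set.encard_coe_eq_coe_finsetCard, ← hinj.encard_image]
  apply Set.encard_le_encard
  rintro _ ⟨k, hk, rfl⟩
  exact ⟨length_window _ _, isFactor_window _ _, hP k (by simpa using hk)⟩

/-! ### Local periods and open complexity. -/

/-- The factor of length `n` of `x` at position `m` has period `p`. -/
def HasPeriodAt (x : ℕ → A) (m n p : ℕ) : Prop :=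
  ∀ t, t + p < n → x (m + t) = x (m + t + p)

theorem HasPeriodAt.apply {m n p : ℕ} (h : HasPeriodAt x m n p) {a c : ℕ} (h1 : m ≤ a)
    (h2 : a + p = c) (h3 : c < m + n) : x a = x c := by
  have := h (a - m) (by omega)
  rwa [show m + (a - m) = a by omega, h2] at this

theorem HasPeriodAt.mono {m n p m' n' : ℕ} (h : HasPeriodAt x m n p) (h1 : m ≤ m')
    (h2 : m' + n' ≤ m + n) : HasPeriodAt x m' n' p :=
  fun _ _ => h.apply (by omega) rfl (by omega)

theorem Agree.hasPeriodAt {m p n : ℕ} (h : Agree x m (m + p) n) : HasPeriodAt x m (n + p) p := by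
  intro t ht
  rw [h t (by omega)]
  congr 1
  omega

theorem Agree.hasPeriodAt_iff {i j n p : ℕ} (h : Agree x i j n) :
    HasPeriodAt x i n p ↔ HasPeriodAt x j n p := by
  refine forall₂_congr fun t ht => ?_
  rw [h t (by omega), add_assoc, add_assoc, h (t + p) ht]

theorem openWord_window_iff {m n : ℕ} (hn : 2 ≤ n) :
    OpenWord (window x m n) ↔ ∀ q b, 0 < b → q + b = n → ¬ IsReturn x m q b := by
  unfold OpenWord
  rw [closedWord_window_iff]
  constructor
  · rintro ⟨-, h⟩ q b hb hqb hr
    exact h (Or.inr ⟨q, b, hb, hqb, hr⟩)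
  · intro h
    refine ⟨fun h0 => ?_, ?_⟩
    · have := congrArg List.length h0
      simp at this
      omega
    · rintro (h1 | ⟨q, b, hb, hqb, hr⟩)
      · omega
      · exact h q b hb hqb hr

/-- An aperiodic word with arbitrarily long factors of period `p` has many open factors, namely
long `p`-periodic words followed by a short word that starts with a break of the period. -/
theorem le_openComplexity_of_long_periods (hx : Aperiodic x) {p : ℕ} (hp : 0 < p)
    (hper : ∀ n, ∃ m, HasPeriodAt x m n p) (J n : ℕ) (hn : 2 * J + 2 * p + 2 ≤ n) :
    (J : ℕ∞) ≤ openComplexity x n := by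
  classical
  obtain ⟨m, hm⟩ := hper n
  have hbreak : ∃ e, m ≤ e ∧ x (e + p) ≠ x e := by
    by_contra! hcon
    exact hx (ultimatelyPeriodic_of_forall hp hcon)
  obtain ⟨e, ⟨hme, hne⟩, hmin⟩ : ∃ e, (m ≤ e ∧ x (e + p) ≠ x e) ∧
      ∀ y < e, ¬ (m ≤ y ∧ x (y + p) ≠ x y) :=
    ⟨Nat.find hbreak, Nat.find_spec hbreak, fun y hy => Nat.find_min hbreak hy⟩
  have hP : ∀ y, m ≤ y → y < e → x (y + p) = x y := by
    intro y h1 h2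
    have := hmin y h2
    by_contra hcon
    exact this ⟨h1, hcon⟩
  have hen : m + n ≤ e + p := by
    by_contra! hcon
    exact hne (hm.apply hme rfl (by omega)).symm
  refine le_encard_factor (fun j => e + p - (n - (j + 1))) ?_ ?_
  · intro j hj
    rw [openWord_window_iff (by omega)]
    rintro q b hb hqb ⟨hq, hag, hmi⟩
    have hsm : m ≤ e + p - (n - (j + 1)) := by omega
    have hse : e + p - (n - (j + 1)) + (n - (j + 1)) = e + p := by omega
    generalize e + p - (n - (j + 1)) = s at *
    -- Otherwise the border and its shift by `p` both lie in the run, so it recurs after `p < q`.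
    have hqs : q < j + 1 + p := by
      by_contra! hcon
      refine hmi p hp (by omega) fun t ht => ?_
      rw [show s + p + t = s + t + p by omega]
      exact (hP _ (by omega) (by omega)).symm
    -- The square `e + p`, `e + p - q`, `e - q`, `e` now contradicts the break at `e`.
    have hag' : ∀ y z, s ≤ y → y < s + b → z = y + q → x y = x z := fun y z h1 h2 h3 =>
      hag.apply h1 h2 (by omega)
    have e1 : x (e + p - q) = x (e + p) := hag' _ _ (by omega) (by omega) (by omega)
    have e2 : x (e - q) = x e := hag' _ _ (by omega) (by omega) (by omega)
    have e3 : x (e - q + p) = x (e - q) := hP _ (by omega) (by omega)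
    rw [show e - q + p = e + p - q by omega] at e3
    exact hne (by rw [← e1, e3, e2])
  · intro j j' hjj hj' hag
    have h1 : m ≤ e + p - (n - (j + 1)) := by omega
    have hag' : ∀ y z, e + p - (n - (j + 1)) ≤ y → y < e + p - (n - (j + 1)) + n →
        z = y + (j' - j) → x y = x z := fun y z h1 h2 h3 =>
      hag.apply h1 h2 (by omega)
    have e1 := hag' (e + p - (j' - j)) (e + p) (by omega) (by omega) (by omega)
    have e2 := hag' (e - (j' - j)) e (by omega) (by omega) (by omega)
    have e3 := hP (e - (j' - j)) (by omega) (by omega)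
    rw [show e - (j' - j) + p = e + p - (j' - j) by omega] at e3
    exact hne (by rw [← e1, e3, e2])

/-- If consecutive windows of length `n` are closed with borders of different lengths, then the
word has a long factor with a short period. -/
theorem exists_hasPeriodAt_of_isReturn {m h n q b q' b' : ℕ} (hh : 0 < h) (hqb : q + b = n)
    (hqb' : q' + b' = n) (hr : IsReturn x m q b) (hr' : IsReturn x (m + h) q' b')
    (hb : h ≤ b) (hne : b ≠ b') :
    ∃ y p, 0 < p ∧ p < h ∧ HasPeriodAt x y (b - h) p := by
  obtain ⟨hq, hag, hmin⟩ := hr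
  obtain ⟨hq', hag', hmin'⟩ := hr'
  have h1 : b < b' + h := by
    by_contra! hcon
    exact hmin' q hq (by omega) (hag.shift h rfl (by omega) (by omega))
  have h2 : b' < b + h := by
    by_contra! hcon
    refine hmin (q - q') (by omega) (by omega) (hag.trans ?_)
    exact hag'.symm.shift (q - q' - h) (by omega) (by omega) (by omega)
  -- The `b - h` letters at `m + h` recur after both `q` and `q'`, hence agree with themselves at
  -- distance `|q - q'| < h`.
  rcases lt_or_gt_of_ne hne with hlt | hlt
  · refine ⟨m + h + q', q - q', by omega, by omega, ?_⟩
    have e1 : Agree x (m + h) (m + h + q') (b - h) := hag'.mono (by omega)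
    have e2 : Agree x (m + h) (m + h + q) (b - h) := hag.shift h rfl (by omega) (by omega)
    have e3 := e1.symm.trans e2
    rw [show m + h + q = m + h + q' + (q - q') by omega] at e3
    exact e3.hasPeriodAt.mono le_rfl (by omega)
  · refine ⟨m + h + q, q' - q, by omega, by omega, ?_⟩
    have e1 : Agree x (m + h) (m + h + q') (b - h) := hag'.mono (by omega)
    have e2 : Agree x (m + h) (m + h + q) (b - h) := hag.shift h rfl (by omega) (by omega)
    have e3 := e2.symm.trans e1
    rw [show m + h + q' = m + h + q + (q' - q) by omega] at e3
    exact e3.hasPeriodAt.mono le_rfl (by omega)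


/-- Among `K + 1` consecutive windows no two are equal, since equality would force a period at most
`K`; so they cannot all be open. -/
theorem exists_closed_of_no_long_period {m n K C : ℕ} (hn : 2 ≤ n) (hCn : C ≤ n)
    (hC : ∀ p, 0 < p → p ≤ K → ∀ y, ¬ HasPeriodAt x y C p)
    (hop : openComplexity x n ≤ K) :
    ∃ h ≤ K, ∃ q b, 0 < b ∧ q + b = n ∧ IsReturn x (m + h) q b := by
  by_contra! hcon
  have := le_encard_factor (x := x) (n := n) (K := K + 1) (P := OpenWord) (fun k => m + k)
    (fun k hk => by
      rw [openWord_window_iff hn]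
      intro q b hb hqb
      exact hcon k (by omega) q b hb hqb)
    (fun k k' hk hk' hag => by
      rw [show m + k' = m + k + (k' - k) by omega] at hag
      exact hC (k' - k) (by omega) (by omega) (m + k) (hag.hasPeriodAt.mono le_rfl (by omega)))
  have h2 := this.trans hop
  rw [Nat.cast_le] at h2
  omega

theorem lt_openComplexity_of_no_long_period [Finite A] (hx : Aperiodic x) {K C n : ℕ}
    (hC : ∀ p, 0 < p → p ≤ K + 1 → ∀ y, ¬ HasPeriodAt x y C p)
    (hn : C + K + 1 + (K + 1) * (Nat.card (Fin (C + K + 1) → A) + 2) < n) :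
    (K : ℕ∞) < openComplexity x n := by
  by_contra! hop
  have hn2 : 2 ≤ n := by nlinarith
  have hCn : C ≤ n := by nlinarith
  have hcl : ∀ m, ∃ h ≤ K, ∃ q b, 0 < b ∧ q + b = n ∧ IsReturn x (m + h) q b := fun m =>
    exists_closed_of_no_long_period hn2 hCn (fun p h1 h2 => hC p h1 (by omega)) hop
  -- A longer border passes its length on to the next closed window, at most `K + 1` further, so the
  -- period `q` propagates forever.
  have hsmall : ∀ m q b, 0 < b → q + b = n → IsReturn x m q b → b < C + K + 1 := by
    intro m q b hb hqb hr
    by_contra! hbig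
    have hall : ∀ k, ∃ m', m' ≤ m + k ∧ m + k ≤ m' + K ∧ IsReturn x m' q b := by
      intro k
      induction k with
      | zero => exact ⟨m, le_rfl, by omega, hr⟩
      | succ k ih =>
        obtain ⟨m', h1, h2, h3⟩ := ih
        rcases Nat.lt_or_ge (m + k) (m' + K) with h4 | h4
        · exact ⟨m', by omega, by omega, h3⟩
        · obtain ⟨h, hh, q', b', hb', hqb', hr'⟩ := hcl (m' + 1)
          rw [add_assoc] at hr'
          have hbb : b = b' := by
            by_contra hne
            obtain ⟨y, p, hp, hp', hper⟩ :=
              exists_hasPeriodAt_of_isReturn (by omega) hqb hqb' h3 hr' (by omega) hne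
            exact hC p hp (by omega) y (hper.mono le_rfl (by omega))
          have hqq : q = q' := by omega
          subst hbb hqq
          exact ⟨_, by omega, by omega, hr'⟩
    refine hx (ultimatelyPeriodic_of_forall (q := q) (N := m) hr.1 fun y hy => ?_)
    obtain ⟨m', h1, h2, h3⟩ := hall (y - m)
    exact (h3.2.1.apply (by omega) (by omega) (by omega)).symm
  choose h hh q b hb hqb hr using fun k => hcl (k * (K + 1))
  have := Fintype.ofFinite A
  -- With one more block than there are words of length `C + K + 1`, two closed windows start alike;
  -- the bound on `n` makes their distance less than `q = n - b`.
  obtain ⟨k, k', hne, heq⟩ := Fintype.exists_ne_map_eq_of_card_lt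
    (fun (k : Fin (Nat.card (Fin (C + K + 1) → A) + 1)) (t : Fin (C + K + 1)) =>
      x (k * (K + 1) + h k + t))
    (by rw [Nat.card_eq_fintype_card, Fintype.card_fin]; exact Nat.lt_succ_self _)
  wlog hlt : k < k' generalizing k k'
  · exact this k' k hne.symm heq.symm (lt_of_le_of_ne (not_lt.1 hlt) hne.symm)
  have hlt' : (k : ℕ) < k' := hlt
  have hk' := k'.2
  generalize (k : ℕ) = i at *
  generalize (k' : ℕ) = j at *
  have hag : Agree x (i * (K + 1) + h i) (j * (K + 1) + h j) (C + K + 1) :=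
    fun t ht => congrFun heq ⟨t, ht⟩
  have hbi := hsmall _ _ _ (hb i) (hqb i) (hr i)
  have h1 : (i + 1) * (K + 1) ≤ j * (K + 1) := Nat.mul_le_mul_right _ hlt'
  have h2 : j * (K + 1) ≤ (Nat.card (Fin (C + K + 1) → A)) * (K + 1) :=
    Nat.mul_le_mul_right _ (by omega)
  have h3 := hh i
  have h4 := hh j
  have h5 := hqb i
  have h6 : (i + 1) * (K + 1) = i * (K + 1) + (K + 1) := by ring
  have h7 : (K + 1) * (Nat.card (Fin (C + K + 1) → A) + 2) =
    (Nat.card (Fin (C + K + 1) → A)) * (K + 1) + 2 * (K + 1) := by ring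
  refine (hr i).2.2 (j * (K + 1) + h j - (i * (K + 1) + h i)) (by omega) (by omega) ?_
  rw [Nat.add_sub_cancel' (by omega)]
  exact hag.mono (by omega)

theorem liminf_openComplexity_eq_top [Finite A] (hx : Aperiodic x) :
    Filter.liminf (fun n : ℕ => openComplexity x n) Filter.atTop = (⊤ : ℕ∞) := by
  rw [ENat.eq_top_iff_forall_ge]
  intro K
  refine Filter.le_liminf_of_le (by isBoundedDefault) ?_
  by_cases hA : ∃ p, 0 < p ∧ ∀ n, ∃ m, HasPeriodAt x m n p
  · obtain ⟨p, hp, hper⟩ := hA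
    filter_upwards [Filter.eventually_ge_atTop (2 * K + 2 * p + 2)] with n hn
    exact le_openComplexity_of_long_periods hx hp hper K n hn
  · push Not at hA
    choose! C hC using hA
    have hCs : ∀ p, 0 < p → p ≤ K + 1 → ∀ y,
        ¬ HasPeriodAt x y (∑ p ∈ Finset.range (K + 2), C p) p := by
      intro p hp hpK y hy
      refine hC p hp y (hy.mono le_rfl ?_)
      have := Finset.single_le_sum (f := C) (fun _ _ => Nat.zero_le _)
        (Finset.mem_range.2 (show p < K + 2 by omega))
      omega
    filter_upwards [Filter.eventually_gt_atTop _] with n hn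
    exact (lt_openComplexity_of_no_long_period hx hCs hn).le

/-! ### Wide returns and closed complexity. -/

/-- Some factor of length at least `B` has a return, longer than `D`, such that its two successive
occurrences have the same `D` letters on either side. -/
def HasWideReturn (x : ℕ → A) (D B : ℕ) : Prop :=
  ∃ i q b, D < q ∧ B ≤ b ∧ IsReturn x (i + D) q b ∧ Agree x i (i + q) (b + 2 * D)

/-- Of the slack `d + K` on each side, `K` pays for sliding the window and `d` for varying its
length. Each border contains the `b`-factor at `i + (d + K)`, so it cannot recur before `q`. -/
theorem le_closedComplexity_of_isReturn {i q b d K n : ℕ} (hd : 0 < d) (hq : d + K < q)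
    (hr : IsReturn x (i + (d + K)) q b) (hag : Agree x i (i + q) (b + 2 * (d + K)))
    (hn : q + b + (d + K) ≤ n) (hn' : n ≤ q + b + (d + K) + d) :
    ((K + 1 : ℕ) : ℕ∞) ≤ closedComplexity x n := by
  refine le_encard_factor (fun k => i + k) ?_ ?_
  · intro k hk
    rw [closedWord_window_iff]
    refine Or.inr ⟨q, n - q, by omega, by omega, by omega,
      hag.shift k rfl (by omega) (by omega), fun r hr0 hrq h => ?_⟩
    exact hr.2.2 r hr0 hrq (h.shift (d + K - k) (by omega) (by omega) (by omega))
  · intro k k' hkk hk' h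
    exact hr.2.2 (k' - k) (by omega) (by omega)
      (h.shift (d + K - k) (by omega) (by omega) (by omega))

theorem limsup_closedComplexity_eq_top (hx : ∀ D B, HasWideReturn x D B) {S : Set ℕ}
    (hS : Syndetic S) :
    Filter.limsup (fun n : ℕ => closedComplexity x n) (Filter.atTop ⊓ Filter.principal S) =
      (⊤ : ℕ∞) := by
  obtain ⟨d, hd, hS⟩ := hS
  rw [ENat.eq_top_iff_forall_ge]
  intro K
  refine Filter.le_limsup_of_frequently_le ?_ (by isBoundedDefault)
  rw [Filter.frequently_inf_principal, Filter.frequently_atTop]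
  intro N
  obtain ⟨i, q, b, hq, hb, hr, hag⟩ := hx (d + K) N
  obtain ⟨n, hnS, hn1, hn2⟩ := hS (q + b + (d + K))
  refine ⟨n, by omega, hnS, le_trans ?_ (le_closedComplexity_of_isReturn hd hq hr hag hn1 hn2)⟩
  exact_mod_cast Nat.le_succ K

/-! ### Nonperiodic positions and bounded clusters. -/

/-- The positions at which the factor of length `w` of `x` has no period in `{1, …, D}`. -/
def nonperiodicPositions (x : ℕ → A) (D w : ℕ) : Set ℕ :=
  {j | ∀ p, 0 < p → p ≤ D → ¬ HasPeriodAt x j w p}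

theorem exists_period_of_notMem {D w j : ℕ} (h : j ∉ nonperiodicPositions x D w) :
    ∃ p, 0 < p ∧ p ≤ D ∧ HasPeriodAt x j w p := by
  simpa [nonperiodicPositions] using h

theorem Agree.mem_nonperiodicPositions_iff {D w i j : ℕ} (h : Agree x i j w) :
    i ∈ nonperiodicPositions x D w ↔ j ∈ nonperiodicPositions x D w :=
  forall₃_congr fun _ _ _ => not_congr h.hasPeriodAt_iff

/-- Consecutive `w`-factors overlap in at least `2 * D` letters, so, as in Fine and Wilf, a period
of one passes to the next. -/
theorem nonperiodicPositions_infinite (hx : Aperiodic x) {D w : ℕ} (hw : 2 * D + 1 ≤ w) (N : ℕ) :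
    ∃ j, N ≤ j ∧ j ∈ nonperiodicPositions x D w := by
  by_contra! hcon
  obtain ⟨p, hp, hpD, hper⟩ := exists_period_of_notMem (hcon N le_rfl)
  have hall : ∀ k, HasPeriodAt x (N + k) w p := by
    intro k
    induction k with
    | zero => exact hper
    | succ k ih =>
      obtain ⟨p', hp', hpD', hper'⟩ := exists_period_of_notMem (hcon (N + (k + 1)) (by omega))
      intro t ht
      rcases Nat.lt_or_ge (t + 1 + p) w with h | h
      · exact ih.apply (by omega) rfl (by omega)
      · have e1 : x (N + k + w - p') = x (N + k + w) := hper'.apply (by omega) (by omega) (by omega)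
        have e2 : x (N + k + w - p - p') = x (N + k + w - p) :=
          hper'.apply (by omega) (by omega) (by omega)
        have e3 : x (N + k + w - p - p') = x (N + k + w - p') :=
          ih.apply (by omega) (by omega) (by omega)
        rw [show N + (k + 1) + t + p = N + k + w by omega,
          show N + (k + 1) + t = N + k + w - p by omega, ← e1, ← e2, e3]
  refine hx (ultimatelyPeriodic_of_forall (N := N) hp fun y hy => ?_)
  exact ((hall (y - N)).apply (by omega) rfl (by omega)).symm

/-- The two periods may differ, but `w ≥ 2 * D + 1` leaves room to go back by `p` and `p'` in either
order inside the common part. -/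
theorem Agree.extend_right_one {D w i j : ℕ} (hw : 2 * D + 1 ≤ w) (h : Agree x i j w)
    (hi : i + 1 ∉ nonperiodicPositions x D w) (hj : j + 1 ∉ nonperiodicPositions x D w) :
    x (i + w) = x (j + w) := by
  obtain ⟨p, hp, hpD, hper⟩ := exists_period_of_notMem hi
  obtain ⟨p', hp', hpD', hper'⟩ := exists_period_of_notMem hj
  have e1 : x (i + w - p) = x (i + w) := hper.apply (by omega) (by omega) (by omega)
  have e2 : x (j + w - p') = x (j + w) := hper'.apply (by omega) (by omega) (by omega)
  have e3 : x (i + w - p') = x (j + w - p') := h.apply (by omega) (by omega) (by omega)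
  have e4 : x (i + w - p) = x (j + w - p) := h.apply (by omega) (by omega) (by omega)
  have e5 : x (j + w - p - p') = x (j + w - p) := hper'.apply (by omega) (by omega) (by omega)
  have e6 : x (i + w - p - p') = x (i + w - p') := hper.apply (by omega) (by omega) (by omega)
  have e7 : x (i + w - p - p') = x (j + w - p - p') := h.apply (by omega) (by omega) (by omega)
  rw [← e1, ← e2, ← e3, ← e6, e7, e5, e4]

theorem Agree.extend_left_one {D w i j : ℕ} (hw : 2 * D + 1 ≤ w) (h : Agree x (i + 1) (j + 1) w)
    (hi : i ∉ nonperiodicPositions x D w) (hj : j ∉ nonperiodicPositions x D w) :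
    x i = x j := by
  obtain ⟨p, hp, hpD, hper⟩ := exists_period_of_notMem hi
  obtain ⟨p', hp', hpD', hper'⟩ := exists_period_of_notMem hj
  have e1 : x i = x (i + p) := hper.apply (by omega) (by omega) (by omega)
  have e2 : x j = x (j + p') := hper'.apply (by omega) (by omega) (by omega)
  have e3 : x (i + p') = x (j + p') := h.apply (by omega) (by omega) (by omega)
  have e4 : x (i + p) = x (j + p) := h.apply (by omega) (by omega) (by omega)
  have e5 : x (j + p) = x (j + p + p') := hper'.apply (by omega) (by omega) (by omega)
  have e6 : x (i + p') = x (i + p + p') := hper.apply (by omega) (by omega) (by omega)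
  have e7 : x (i + p + p') = x (j + p + p') := h.apply (by omega) (by omega) (by omega)
  rw [e1, e4, e5, ← e7, ← e6, e3, e2]

theorem Agree.extend_right {D w i j n : ℕ} (hw : 2 * D + 1 ≤ w) (hn : w ≤ n)
    (h : Agree x i j n) (g : ℕ)
    (hi : ∀ t, n - w < t → t ≤ n - w + g → i + t ∉ nonperiodicPositions x D w)
    (hj : ∀ t, n - w < t → t ≤ n - w + g → j + t ∉ nonperiodicPositions x D w) :
    Agree x i j (n + g) := by
  induction g with
  | zero => exact h
  | succ g ih =>
    have ih := ih (fun t h1 h2 => hi t h1 (by omega)) (fun t h1 h2 => hj t h1 (by omega))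
    intro t ht
    rcases Nat.lt_or_ge t (n + g) with h1 | h1
    · exact ih t h1
    · have e := Agree.extend_right_one (i := i + (n - w + g)) (j := j + (n - w + g)) hw
        (ih.shift (n - w + g) rfl rfl (by omega)) (hi (n - w + (g + 1)) (by omega) le_rfl)
        (hj (n - w + (g + 1)) (by omega) le_rfl)
      rwa [show i + (n - w + g) + w = i + t by omega,
        show j + (n - w + g) + w = j + t by omega] at e

theorem Agree.extend_left {D w i j n : ℕ} (hw : 2 * D + 1 ≤ w) (hn : w ≤ n) (g : ℕ)
    (h : Agree x (i + g) (j + g) n)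
    (hi : ∀ t, t < g → i + t ∉ nonperiodicPositions x D w)
    (hj : ∀ t, t < g → j + t ∉ nonperiodicPositions x D w) :
    Agree x i j (n + g) := by
  induction g generalizing i j with
  | zero => exact h
  | succ g ih =>
    have ih := ih (i := i + 1) (j := j + 1) (h.shift 0 (by omega) (by omega) (by omega))
      (fun t ht => by simpa [add_assoc, add_comm 1] using hi (t + 1) (by omega))
      (fun t ht => by simpa [add_assoc, add_comm 1] using hj (t + 1) (by omega))
    intro t ht
    rcases Nat.eq_zero_or_pos t with rfl | h1
    · exact Agree.extend_left_one (i := i) (j := j) hw (ih.mono (by omega)) (hi 0 (by omega))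
        (hj 0 (by omega))
    · exact ih.apply (by omega) (by omega) (by omega)

/-- The points of `E` between `a` and `c`, both in `E`, have gaps at most `G`. -/
def IsChain (E : Set ℕ) (G a c : ℕ) : Prop :=
  a ∈ E ∧ c ∈ E ∧ a ≤ c ∧ ∀ j, a ≤ j → j < c → ∃ e ∈ E, j < e ∧ e ≤ j + G

theorem IsChain.trans {E : Set ℕ} {G a b c : ℕ} (h : IsChain E G a b) (h' : IsChain E G b c) :
    IsChain E G a c := by
  refine ⟨h.1, h'.2.1, h.2.2.1.trans h'.2.2.1, fun j h1 h2 => ?_⟩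
  rcases Nat.lt_or_ge j b with h3 | h3
  · exact h.2.2.2 j h1 h3
  · exact h'.2.2.2 j h3 h2

theorem isChain_pair {E : Set ℕ} {G a c : ℕ} (ha : a ∈ E) (hc : c ∈ E) (h : a ≤ c)
    (h' : c ≤ a + G) : IsChain E G a c :=
  ⟨ha, hc, h, fun _ _ h2 => ⟨c, hc, h2, by omega⟩⟩

/-- Here `l` is the largest length attained arbitrarily far out; the finitely many larger candidates
eventually disappear. -/
theorem exists_maximal_chain {E : Set ℕ} {G L : ℕ} (hE : ∀ N, ∃ j, N ≤ j ∧ j ∈ E)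
    (hL : ∀ a c, IsChain E G a c → c < a + L) :
    ∃ l N, {a | N ≤ a ∧ IsChain E G a (a + l)}.Infinite ∧
      ∀ a c, N ≤ a → IsChain E G a c → c ≤ a + l := by
  classical
  let P : ℕ → Prop := fun l => ∃ᶠ a in Filter.atTop, IsChain E G a (a + l)
  have h0 : P 0 := by
    refine Filter.frequently_atTop.2 fun N => ?_
    obtain ⟨j, h1, h2⟩ := hE N
    exact ⟨j, h1, isChain_pair h2 h2 (by omega) (by omega)⟩
  have hg : P (Nat.findGreatest P L) := Nat.findGreatest_spec (Nat.zero_le L) h0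
  have hev : ∀ᶠ a in Filter.atTop, ∀ l' ∈ Finset.Ioc (Nat.findGreatest P L) L,
      ¬ IsChain E G a (a + l') := by
    rw [Filter.eventually_all_finset]
    intro l' hl'
    rw [Finset.mem_Ioc] at hl'
    exact Filter.not_frequently.1 (Nat.findGreatest_is_greatest hl'.1 hl'.2)
  obtain ⟨N, hN⟩ := Filter.eventually_atTop.1 hev
  refine ⟨Nat.findGreatest P L, N, ?_, ?_⟩
  · have := hg.and_eventually (Filter.eventually_ge_atTop N)
    rw [Nat.frequently_atTop_iff_infinite] at this
    exact this.mono fun a ha => ⟨ha.2, ha.1⟩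
  · intro a c ha hc
    by_contra! hcon
    have := hL a c hc
    refine hN a ha (c - a) (by rw [Finset.mem_Ioc]; omega) ?_
    rwa [Nat.add_sub_cancel' hc.2.2.1]

/-- If the nonperiodic positions form clusters of bounded size, then there is a wide return,
around two clusters of maximal size. -/
theorem hasWideReturn_of_bounded_chains [Finite A] (hx : Aperiodic x) {D w L : ℕ}
    (hw : 2 * D + 1 ≤ w)
    (hL : ∀ a c, IsChain (nonperiodicPositions x D w) (D + 1) a c → c < a + L) :
    HasWideReturn x D w := by
  classical
  obtain ⟨l, N, hinf, hmax⟩ :=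
    exists_maximal_chain (nonperiodicPositions_infinite hx hw) hL
  set E := nonperiodicPositions x D w with hE
  -- The bound on `a` keeps every chain prolonged to the left beyond `N`, and makes `a - 1 - D` a
  -- genuine subtraction.
  have hout : ∀ a, N + D + 2 ≤ a → IsChain E (D + 1) a (a + l) →
      (∀ y, a ≤ y + D + 1 → y < a → y ∉ E) ∧ (∀ y, a + l < y → y ≤ a + l + D + 1 → y ∉ E) := by
    intro a ha hc
    constructor
    · intro y h1 h2 hy
      have := hmax y _ (by omega) ((isChain_pair hy hc.1 (by omega) (by omega)).trans hc)
      omega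
    · intro y h1 h2 hy
      have := hmax a y (by omega) (hc.trans (isChain_pair hc.2.1 hy (by omega) (by omega)))
      omega
  have hinf' : {a | N + D + 2 ≤ a ∧ IsChain E (D + 1) a (a + l)}.Infinite := by
    have h1 := hinf.sdiff (Set.finite_lt_nat (N + D + 2))
    refine h1.mono fun a ha => ⟨?_, ha.1.2⟩
    have := ha.2
    simpa using this
  obtain ⟨a, ⟨haN, hchain⟩, a', ⟨-, hchain'⟩, hlt, heq⟩ :=
    hinf'.exists_lt_map_eq_of_mapsTo (f := fun (a : ℕ) (t : Fin (l + 2 + w)) => x (a - 1 + t))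
      (Set.mapsTo_univ _ _) Set.finite_univ
  have hex : ∃ q, 0 < q ∧ Agree x (a - 1) (a - 1 + q) (l + 2 + w) := by
    refine ⟨a' - a, by omega, fun t ht => ?_⟩
    rw [show a - 1 + (a' - a) = a' - 1 by omega]
    exact congrFun heq ⟨t, ht⟩
  obtain ⟨q, ⟨hq, hag⟩, hmin⟩ : ∃ q, (0 < q ∧ Agree x (a - 1) (a - 1 + q) (l + 2 + w)) ∧
      ∀ k < q, ¬ (0 < k ∧ Agree x (a - 1) (a - 1 + k) (l + 2 + w)) :=
    ⟨Nat.find hex, Nat.find_spec hex, fun _ h => Nat.find_min hex h⟩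
  -- Membership in `E` depends only on the `w`-factor, so the cluster is copied to `a + q`, where it
  -- is again maximal.
  have htr : ∀ y, a ≤ y → y ≤ a + l → (y ∈ E ↔ y + q ∈ E) := fun y h1 h2 =>
    Agree.mem_nonperiodicPositions_iff (hag.shift (y - (a - 1)) (by omega) (by omega) (by omega))
  have hchq : IsChain E (D + 1) (a + q) (a + q + l) := by
    refine ⟨(htr a le_rfl (by omega)).1 hchain.1, ?_, by omega, fun j h1 h2 => ?_⟩
    · have := (htr (a + l) (by omega) le_rfl).1 hchain.2.1
      rwa [add_right_comm] at this
    · obtain ⟨e, heE, h3, h4⟩ := hchain.2.2.2 (j - q) (by omega) (by omega)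
      rcases Nat.lt_or_ge (a + l) e with h5 | h5
      · exact ⟨a + l + q, (htr (a + l) (by omega) le_rfl).1 hchain.2.1, by omega, by omega⟩
      · exact ⟨e + q, (htr e (by omega) h5).1 heE, by omega, by omega⟩
  obtain ⟨hl1, hr1⟩ := hout a haN hchain
  obtain ⟨hl2, hr2⟩ := hout (a + q) (by omega) hchq
  have hDq : D < q := by
    by_contra! hcon
    exact hr1 (a + q + l) (by omega) (by omega) hchq.2.1
  have hi : a - 1 - D + D = a - 1 := by omega
  refine ⟨a - 1 - D, q, l + 2 + w, hDq, by omega, ?_, ?_⟩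
  · rw [hi]
    exact ⟨hq, hag, fun k h1 h2 h3 => hmin k h2 ⟨h1, h3⟩⟩
  · have h1 : Agree x (a - 1 - D) (a - 1 - D + q) (l + 2 + w + D) := by
      refine Agree.extend_left hw (by omega) D ?_ ?_ ?_
      · rwa [add_right_comm, hi]
      · exact fun t ht => hl1 _ (by omega) (by omega)
      · exact fun t ht => hl2 _ (by omega) (by omega)
    have h2 := h1.extend_right hw (by omega) D
      (fun t h3 h4 => hr1 _ (by omega) (by omega)) (fun t h3 h4 => hr2 _ (by omega) (by omega))
    exact h2.mono (by omega)

/-! ### A finitely subadditive density. -/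

open Classical in
/-- The proportion of elements of `P` in the `k`-th of the intervals `[a k, a k + k]`. -/
noncomputable def proportion (a : ℕ → ℕ) (P : Set ℕ) (k : ℕ) : ℝ :=
  (((Finset.Ico (a k) (a k + (k + 1))).filter (· ∈ P)).card : ℝ) / (k + 1)

/-- A finitely additive density on sets of natural numbers: the limit, along an ultrafilter, of
the proportions in longer and longer intervals. -/
noncomputable def density (a : ℕ → ℕ) (P : Set ℕ) : ℝ :=
  (Filter.hyperfilter ℕ : Filter ℕ).limUnder (proportion a P)

variable {a : ℕ → ℕ}

theorem proportion_mem_Icc (P : Set ℕ) (k : ℕ) : proportion a P k ∈ Set.Icc (0 : ℝ) 1 := by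
  classical
  refine ⟨by unfold proportion; positivity, ?_⟩
  unfold proportion
  rw [div_le_one (by positivity)]
  have := Finset.card_filter_le (Finset.Ico (a k) (a k + (k + 1))) (· ∈ P)
  simp only [Nat.card_Ico, Nat.add_sub_cancel_left] at this
  exact_mod_cast this

/-- Proportions lie in the compact `[0, 1]`, so the ultrafilter limit exists and `limUnder` is not a
default value. -/
theorem tendsto_density (P : Set ℕ) :
    Filter.Tendsto (proportion a P) (Filter.hyperfilter ℕ) (nhds (density a P)) := by
  obtain ⟨l, -, hl⟩ := (isCompact_Icc (a := (0 : ℝ)) (b := 1)).ultrafilter_le_nhds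
    ((Filter.hyperfilter ℕ).map (proportion a P))
    (by
      rw [Ultrafilter.coe_map, Filter.le_principal_iff, Filter.mem_map]
      exact Filter.univ_mem' fun k => proportion_mem_Icc P k)
  exact tendsto_nhds_limUnder ⟨l, hl⟩

theorem tendsto_const_div_hyperfilter (M : ℝ) :
    Filter.Tendsto (fun k : ℕ => M / ((k : ℝ) + 1)) (Filter.hyperfilter ℕ) (nhds 0) := by
  have h : Filter.Tendsto (fun k : ℕ => M / ((k : ℝ) + 1)) Filter.atTop (nhds 0) := by
    have := (tendsto_one_div_add_atTop_nhds_zero_nat (𝕜 := ℝ)).const_mul M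
    simpa [div_eq_mul_inv] using this
  exact h.mono_left Nat.hyperfilter_le_atTop

/-- An injection moving points by at most `M` pushes at most `M` of them out of each interval, which
vanishes in the limit. -/
theorem density_le_of_matching {P S : Set ℕ} {M : ℕ} (r : ℕ → ℕ → Prop)
    (hr : ∀ i ∈ P, ∃ s ∈ S, i ≤ s ∧ s ≤ i + M ∧ r i s)
    (hinj : ∀ i i' s, r i s → r i' s → i = i') : density a P ≤ density a S := by
  classical
  choose! f hfS hle hle' hrf using hr
  have hlim := (tendsto_density (a := a) S).add (tendsto_const_div_hyperfilter M)
  rw [add_zero] at hlim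
  refine le_of_tendsto_of_tendsto' (tendsto_density P) hlim fun k => ?_
  unfold proportion
  rw [← add_div]
  gcongr
  have h1 : ((Finset.Ico (a k) (a k + (k + 1))).filter (· ∈ P)).card ≤
      ((Finset.Ico (a k) (a k + (k + 1))).filter (· ∈ S) ∪
        Finset.Ico (a k + (k + 1)) (a k + (k + 1) + M)).card := by
    refine Finset.card_le_card_of_injOn f ?_ ?_
    · intro i hi
      simp only [Finset.coe_filter, Finset.mem_Ico, Set.mem_ofPred_eq] at hi
      have h2 := hle i hi.2
      have h3 := hle' i hi.2
      have h4 := hfS i hi.2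
      simp only [Finset.coe_union, Finset.coe_filter, Finset.coe_Ico, Set.mem_union,
        Set.mem_ofPred_eq, Finset.mem_Ico, Set.mem_Ico]
      rcases Nat.lt_or_ge (f i) (a k + (k + 1)) with h5 | h5
      · exact Or.inl ⟨⟨by omega, h5⟩, h4⟩
      · exact Or.inr ⟨h5, by omega⟩
    · intro i hi i' hi' h
      simp only [Finset.coe_filter, Set.mem_ofPred_eq] at hi hi'
      have h2 := hrf i' hi'.2
      rw [← h] at h2
      exact hinj _ _ _ (hrf i hi.2) h2
  have h2 := h1.trans (Finset.card_union_le _ _)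
  rw [Nat.card_Ico, Nat.add_sub_cancel_left] at h2
  exact_mod_cast h2

theorem density_mono {P S : Set ℕ} (h : P ⊆ S) : density a P ≤ density a S :=
  density_le_of_matching (M := 0) (fun i s => i = s) (fun i hi => ⟨i, h hi, le_rfl, le_rfl, rfl⟩)
    (fun _ _ _ h1 h2 => h1.trans h2.symm)

theorem density_shift_le (P : Set ℕ) (c : ℕ) : density a {i | i + c ∈ P} ≤ density a P :=
  density_le_of_matching (M := c) (fun i s => i + c = s)
    (fun i hi => ⟨i + c, hi, by omega, le_rfl, rfl⟩) (fun _ _ _ h1 h2 => by omega)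

theorem density_union_le (P Q : Set ℕ) : density a (P ∪ Q) ≤ density a P + density a Q := by
  classical
  refine le_of_tendsto_of_tendsto' (tendsto_density _)
    ((tendsto_density P).add (tendsto_density Q)) fun k => ?_
  unfold proportion
  rw [← add_div]
  gcongr
  have := Finset.card_union_le ((Finset.Ico (a k) (a k + (k + 1))).filter (· ∈ P))
    ((Finset.Ico (a k) (a k + (k + 1))).filter (· ∈ Q))
  rw [← Finset.filter_or] at this
  simp only [Set.mem_union]
  exact_mod_cast this

theorem density_le_sum {P : Set ℕ} {r : ℕ} {S : ℕ → Set ℕ}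
    (h : ∀ i ∈ P, ∃ k < r, i ∈ S k) : density a P ≤ ∑ k ∈ Finset.range r, density a (S k) := by
  classical
  refine le_of_tendsto_of_tendsto' (tendsto_density _)
    (tendsto_finsetSum _ fun k _ => tendsto_density (S k)) fun n => ?_
  unfold proportion
  rw [← Finset.sum_div]
  gcongr
  have h1 : (Finset.Ico (a n) (a n + (n + 1))).filter (· ∈ P) ⊆
      (Finset.range r).biUnion fun k => (Finset.Ico (a n) (a n + (n + 1))).filter (· ∈ S k) := by
    intro i hi
    rw [Finset.mem_filter] at hi
    obtain ⟨k, h2, h3⟩ := h i hi.2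
    exact Finset.mem_biUnion.2 ⟨k, Finset.mem_range.2 h2, Finset.mem_filter.2 ⟨hi.1, h3⟩⟩
  exact_mod_cast (Finset.card_le_card h1).trans Finset.card_biUnion_le

open Classical in
theorem sum_density_le {r C : ℕ} {S : ℕ → Set ℕ}
    (h : ∀ y, ((Finset.range r).filter fun k => y ∈ S k).card ≤ C) :
    ∑ k ∈ Finset.range r, density a (S k) ≤ C := by
  refine le_of_tendsto' (tendsto_finsetSum _ fun k _ => tendsto_density (S k)) fun n => ?_
  unfold proportion
  rw [← Finset.sum_div, div_le_iff₀ (by positivity)]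
  have h1 := Finset.sum_card_bipartiteAbove_eq_sum_card_bipartiteBelow
    (s := Finset.range r) (t := Finset.Ico (a n) (a n + (n + 1))) (fun k y => y ∈ S k)
  have h2 : ∑ k ∈ Finset.range r, ((Finset.Ico (a n) (a n + (n + 1))).filter (· ∈ S k)).card ≤
      C * (n + 1) := by
    refine (h1.trans_le (Finset.sum_le_card_nsmul _ _ C fun y _ => h y)).trans ?_
    rw [Nat.card_Ico, Nat.add_sub_cancel_left, smul_eq_mul, mul_comm]
  exact_mod_cast h2

theorem one_le_mul_density {E : Set ℕ} {G : ℕ}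
    (h : ∀ k, ∀ j, a k ≤ j → j < a k + (k + 1) → ∃ e ∈ E, j < e ∧ e ≤ j + G) :
    1 ≤ G * density a E := by
  classical
  have hlim := ((tendsto_density (a := a) E).const_mul (G : ℝ)).add
    (tendsto_const_div_hyperfilter ((G : ℝ) * G))
  rw [add_zero] at hlim
  refine ge_of_tendsto' hlim fun k => ?_
  have hk := h k
  choose! f hfE hlt hle using hk
  have h1 := Finset.card_le_mul_card_image_of_maps_to (s := Finset.Ico (a k) (a k + (k + 1)))
    (t := (Finset.Ico (a k) (a k + (k + 1))).filter (· ∈ E) ∪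
        Finset.Ico (a k + (k + 1)) (a k + (k + 1) + G)) (f := f) (n := G) ?_ ?_
  · have h2 := h1.trans (Nat.mul_le_mul_left G (Finset.card_union_le _ _))
    rw [Nat.card_Ico, Nat.card_Ico, Nat.add_sub_cancel_left, Nat.add_sub_cancel_left] at h2
    unfold proportion
    rw [← mul_div_assoc, ← add_div, le_div_iff₀ (by positivity), one_mul, ← mul_add]
    exact_mod_cast h2
  · intro j hj
    rw [Finset.mem_Ico] at hj
    have h2 := hlt j hj.1 hj.2
    have h3 := hle j hj.1 hj.2
    have h4 := hfE j hj.1 hj.2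
    simp only [Finset.mem_union, Finset.mem_filter, Finset.mem_Ico]
    rcases Nat.lt_or_ge (f j) (a k + (k + 1)) with h5 | h5
    · exact Or.inl ⟨⟨by omega, h5⟩, h4⟩
    · exact Or.inr ⟨h5, by omega⟩
  · intro e _
    have h2 : (Finset.Ico (a k) (a k + (k + 1))).filter (fun j => f j = e) ⊆
        Finset.Ico (e - G) e := by
      intro j hj
      rw [Finset.mem_filter, Finset.mem_Ico] at hj
      have h2 := hlt j hj.1.1 hj.1.2
      have h3 := hle j hj.1.1 hj.1.2
      rw [Finset.mem_Ico]
      omega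
    refine (Finset.card_le_card h2).trans ?_
    rw [Nat.card_Ico]
    omega

/-- The translates of `R` by `0, …, M` cover a point at most as often as there are words of length
`b`, because different translates give different `b`-factors. -/
theorem mul_density_le_of_separated [Finite A] {R : Set ℕ} {M b : ℕ}
    (h : ∀ i ∈ R, ∀ q, 0 < q → q ≤ M → i + q ∈ R → ¬ Agree x i (i + q) b) :
    (M + 1) * density a R ≤ Nat.card (Fin b → A) := by
  classical
  have := Fintype.ofFinite A
  have h1 : ∑ k ∈ Finset.range (M + 1), density a {y | ∃ i ∈ R, y = i + k} ≤
      (Nat.card (Fin b → A) : ℕ) := by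
    refine sum_density_le fun y => ?_
    rw [Nat.card_eq_fintype_card, ← Finset.card_univ]
    refine Finset.card_le_card_of_injOn (fun k t => x (y - k + t)) (fun _ _ => by simp) ?_
    intro k hk k' hk' heq
    simp only [Finset.coe_filter, Finset.mem_range, Set.mem_ofPred_eq] at hk hk'
    obtain ⟨hk, i, hi, hki⟩ := hk
    obtain ⟨hk', i', hi', hki'⟩ := hk'
    beta_reduce at heq
    rw [show y - k = i by omega, show y - k' = i' by omega] at heq
    have key : ∀ i ∈ R, ∀ i' ∈ R, i < i' → i' ≤ i + M →
        (fun t : Fin b => x (i + t)) ≠ fun t : Fin b => x (i' + t) := by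
      intro i hi i' hi' hlt hle heq
      refine h i hi (i' - i) (by omega) (by omega) (by rwa [Nat.add_sub_cancel' hlt.le]) ?_
      rw [Nat.add_sub_cancel' hlt.le]
      exact fun t ht => congrFun heq ⟨t, ht⟩
    rcases lt_trichotomy i i' with hlt | h1 | hlt
    · exact absurd heq (key i hi i' hi' hlt (by omega))
    · omega
    · exact absurd heq.symm (key i' hi' i hi hlt (by omega))
  refine le_trans ?_ h1
  have h2 := Finset.card_nsmul_le_sum (Finset.range (M + 1))
    (fun k => density a {y | ∃ i ∈ R, y = i + k}) (density a R) fun k _ => ?_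
  · rw [Finset.card_range, nsmul_eq_mul] at h2
    exact_mod_cast h2
  exact density_le_of_matching (M := k) (fun i s => s = i + k)
    (fun i hi => ⟨i + k, ⟨i, hi, rfl⟩, by omega, le_rfl, rfl⟩) (fun _ _ _ h1 h2 => by omega)

/-! ### Rarity of late returns. -/

/-- Positions at which the factor of length `b` does not occur again within distance `M`. -/
def noReturn (x : ℕ → A) (b M : ℕ) : Set ℕ :=
  {s | ∀ q, 0 < q → q ≤ M → ¬ Agree x s (s + q) b}

/-- Positions, at least `M`, at which the factor of length `b` has not occurred before within
distance `M`. -/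
def noPriorReturn (x : ℕ → A) (b M : ℕ) : Set ℕ :=
  {s | M ≤ s ∧ ∀ q, 0 < q → q ≤ M → ¬ Agree x (s - q) s b}

theorem exists_density_noReturn_le [Finite A] (x : ℕ → A) (a : ℕ → ℕ) (b : ℕ) {ε : ℝ} (hε : 0 < ε) :
    ∃ M, density a (noReturn x b M) ≤ ε ∧ density a (noPriorReturn x b M) ≤ ε := by
  obtain ⟨M, hM⟩ := exists_nat_gt ((Nat.card (Fin b → A) : ℝ) / ε)
  rw [div_lt_iff₀ hε] at hM
  have key : ∀ R : Set ℕ, (∀ i ∈ R, ∀ q, 0 < q → q ≤ M → i + q ∈ R → ¬ Agree x i (i + q) b) →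
      density a R ≤ ε := by
    intro R hR
    have := mul_density_le_of_separated (a := a) hR
    by_contra! hcon
    have h1 : (M : ℝ) * ε ≤ M * density a R := by gcongr
    nlinarith
  refine ⟨M, key _ fun i hi q h1 h2 _ => hi q h1 h2, key _ fun i _ q h1 h2 hi => ?_⟩
  simpa using hi.2 q h1 h2

theorem card_filter_ne_succ_le {α : Type*} [Finite α] [DecidableEq (Set α)] {F : ℕ → Set α}
    (hF : Monotone F) (r : ℕ) :
    ((Finset.range r).filter fun k => F k ≠ F (k + 1)).card ≤ Nat.card α := by
  have h : ((Finset.range r).filter fun k => F k ≠ F (k + 1)).card ≤ (F r).ncard := by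
    induction r with
    | zero => simp
    | succ r ih =>
      rw [Finset.range_add_one, Finset.filter_insert]
      split_ifs with h
      · have h1 : (F r).ncard < (F (r + 1)).ncard :=
          Set.ncard_lt_ncard ((hF (Nat.le_succ r)).lt_of_ne h) (Set.toFinite _)
        exact (Finset.card_insert_le _ _).trans (by omega)
      · rw [not_not] at h
        rwa [← h]
  exact h.trans (Set.ncard_le_card _)

theorem IsReturn.transfer {m m' q b n : ℕ} (h : IsReturn x m q b) (hag : Agree x m m' n)
    (hn : q + b ≤ n) : IsReturn x m' q b := by
  refine ⟨h.1, ?_, fun k h1 h2 h3 => h.2.2 k h1 h2 ?_⟩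
  · exact ((hag.mono (by omega)).symm.trans h.2.1).trans (hag.shift q rfl rfl hn)
  · exact ((hag.mono (by omega)).trans h3).trans (hag.symm.shift k rfl rfl (by omega))

/-- Supplies the injectivity needed by `density_le_of_matching` when a position is sent to its next
return. -/
theorem IsReturn.start_unique {m m' q q' b : ℕ} (h : IsReturn x m q b) (h' : IsReturn x m' q' b)
    (he : m + q = m' + q') : m = m' := by
  have key : ∀ m m' q q', IsReturn x m q b → IsReturn x m' q' b → m + q = m' + q' →
      ¬ m < m' := by
    intro m m' q q' h h' he hlt
    refine h.2.2 (m' - m) (by omega) (by have := h'.1; omega) ?_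
    rw [Nat.add_sub_cancel' hlt.le]
    refine h.2.1.trans ?_
    rw [he]
    exact h'.2.1.symm
  exact le_antisymm (not_lt.1 (key m' m q' q h' h he.symm)) (not_lt.1 (key m m' q q' h h' he))

theorem exists_isReturn {m q b : ℕ} (hq : 0 < q) (h : Agree x m (m + q) b) :
    ∃ q' ≤ q, IsReturn x m q' b := by
  classical
  have hex : ∃ q, 0 < q ∧ Agree x m (m + q) b := ⟨q, hq, h⟩
  exact ⟨Nat.find hex, Nat.find_min' hex ⟨hq, h⟩, (Nat.find_spec hex).1, (Nat.find_spec hex).2,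
    fun k h1 h2 h3 => Nat.find_min hex h2 ⟨h1, h3⟩⟩

theorem IsReturn.le_of_agree {m q q' b b' : ℕ} (h : IsReturn x m q b) (hq' : 0 < q')
    (hag : Agree x m (m + q') b') (hb : b ≤ b') : q ≤ q' := by
  by_contra! hcon
  exact h.2.2 q' hq' hcon (hag.mono hb)

theorem IsReturn.lt_of_mem {D w m q b : ℕ} (h : IsReturn x m q b)
    (hm : m ∈ nonperiodicPositions x D w) (hb : w ≤ b) : D < q := by
  by_contra! hcon
  exact hm q h.1 hcon (h.2.1.hasPeriodAt.mono le_rfl (by omega))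

theorem exists_agree_of_notMem_noReturn {b M s : ℕ} (h : s ∉ noReturn x b M) :
    ∃ q, 0 < q ∧ q ≤ M ∧ Agree x s (s + q) b := by
  simpa [noReturn] using h

theorem exists_agree_of_notMem_noPriorReturn {b M s : ℕ} (h : s ∉ noPriorReturn x b M)
    (hs : M ≤ s) : ∃ q, 0 < q ∧ q ≤ M ∧ Agree x (s - q) s b := by
  simpa [noPriorReturn, hs] using h

/-! ### Matching the contexts, on the left and then on the right. -/

/-- The positions `i` such that the factor of length `b` at `i + D` returns preceded by the same
`D` letters. -/
def leftMatched (x : ℕ → A) (D b : ℕ) : Set ℕ :=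
  {i | ∃ q, IsReturn x (i + D) q b ∧ Agree x i (i + q) D}

/-- The positions `i` such that the factor of length `w` at `i + D` has no period at most `D`. -/
def shiftedNonperiodic (x : ℕ → A) (D w : ℕ) : Set ℕ :=
  {i | i + D ∈ nonperiodicPositions x D w}

/-- The `b (k + 1)`-factor is long enough to carry the whole shorter return with it to `i + q`. Were
the two left contexts equal, `i + q` would be left matched at scale `l`. -/
theorem exists_notMem_of_matching [Finite A] {D w r k : ℕ} {b M : ℕ → ℕ}
    (hb0 : ∀ l, w ≤ b l) (hbm : Monotone b) (hbM : ∀ k, b k + M k + D ≤ b (k + 1)) (hk : k < r)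
    {i q : ℕ} (hi : i ∈ shiftedNonperiodic x D w) (hR : i + D ∉ noReturn x (b k) (M k))
    (hq : IsReturn x (i + D) q (b (k + 1)))
    (hj : ∀ l ≤ r, i + q ∉ shiftedNonperiodic x D w ∩ leftMatched x D (b l)) :
    ∀ l ≤ k, ∀ q', IsReturn x (i + D) q' (b l) → ¬ Agree x (i + q) (i + q') D := by
  intro l hl q' hq' hag
  obtain ⟨q₀, hq₀, hq₀M, hag₀⟩ := exists_agree_of_notMem_noReturn hR
  have hq'M : q' ≤ M k := (hq'.le_of_agree hq₀ hag₀ (hbm hl)).trans hq₀M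
  have hDq : D < q' := hq'.lt_of_mem hi (hb0 l)
  have h1 : Agree x (i + D) (i + q + D) (b (k + 1)) := by
    rw [add_right_comm]
    exact hq.2.1
  have h2 := hbM k
  have h3 := hbm hl
  refine hj l (by omega) ⟨?_, q', hq'.transfer h1 (by omega), ?_⟩
  · exact (h1.mono (hb0 _)).mem_nonperiodicPositions_iff.1 hi
  · exact hag.trans (h1.shift (q' - D) (by omega) (by omega) (by omega))

/-- If left matching were rare at `r + 1` scales, most positions would meet a new left context at
each step, though there are only `C` contexts. -/
theorem exists_density_leftMatched_ge [Finite A] {D w : ℕ}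
    (hδ : 0 < density a (shiftedNonperiodic x D w)) :
    ∃ c > 0, ∀ B, ∃ b ≥ B, c ≤ density a (shiftedNonperiodic x D w ∩ leftMatched x D b) := by
  classical
  set E := shiftedNonperiodic x D w with hE
  set δ := density a E with hδ'
  set C := Nat.card (Fin D → A)
  obtain ⟨r, hr⟩ := exists_nat_gt (4 * C / δ)
  rw [div_lt_iff₀ hδ] at hr
  have hr0 : (0 : ℝ) < r := by
    have h1 : (0 : ℝ) ≤ 4 * C := by positivity
    exact pos_of_mul_pos_left (h1.trans_lt hr) hδ.le
  refine ⟨δ / (4 * (r + 1)), by positivity, fun B => ?_⟩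
  choose M hM _ using fun b => exists_density_noReturn_le x a b (show 0 < δ / 8 by positivity)
  let b : ℕ → ℕ := fun k => Nat.rec (max B w) (fun _ b => b + M b + D) k
  have hbM : ∀ k, b k + M (b k) + D ≤ b (k + 1) := fun k => le_rfl
  have hbm : Monotone b := monotone_nat_of_le_succ fun k => by have := hbM k; omega
  have hb0 : ∀ k, max B w ≤ b k := fun k => hbm (Nat.zero_le k)
  by_contra! hcon
  let U : Set ℕ := {j | ∃ l ≤ r, j ∈ E ∩ leftMatched x D (b l)}
  have hU : density a U ≤ δ / 4 := by
    have h1 : density a U ≤ ∑ l ∈ Finset.range (r + 1), density a (E ∩ leftMatched x D (b l)) :=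
      density_le_sum fun i ⟨l, hl, hi⟩ => ⟨l, by omega, hi⟩
    have h2 := Finset.sum_le_card_nsmul (Finset.range (r + 1))
      (fun l => density a (E ∩ leftMatched x D (b l))) (δ / (4 * (r + 1)))
      fun l _ => (hcon (b l) ((le_max_left _ _).trans (hb0 l))).le
    rw [Finset.card_range, nsmul_eq_mul] at h2
    refine (h1.trans h2).trans_eq ?_
    push_cast
    field_simp
  -- The `D` letters preceding the next occurrence, collected over the scales up to `k`.
  let F : ℕ → ℕ → Set (Fin D → A) := fun i k =>
    {z | ∃ l ≤ k, ∃ q, IsReturn x (i + D) q (b l) ∧ z = fun t : Fin D => x (i + q + t)}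
  have hF : ∀ i, Monotone (F i) := fun i k k' hk z ⟨l, hl, h⟩ => ⟨l, hl.trans hk, h⟩
  let S : ℕ → Set ℕ := fun k => {i | F i k ≠ F i (k + 1)}
  have hS : ∑ k ∈ Finset.range r, density a (S k) ≤ C :=
    sum_density_le fun i => by
      convert card_filter_ne_succ_le (hF i) r
  let R : ℕ → Set ℕ := fun k => {i | i + D ∈ noReturn x (b k) (M (b k))}
  have hR : ∀ k, density a (R k) ≤ δ / 8 := fun k => (density_shift_le _ D).trans (hM (b k))
  let T : ℕ → Set ℕ := fun k =>
    {i | ∃ q ≤ M (b (k + 1)), IsReturn x (i + D) q (b (k + 1)) ∧ i + q ∈ U}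
  have hT : ∀ k, density a (T k) ≤ density a U := fun k =>
    density_le_of_matching (M := M (b (k + 1)))
      (fun i s => ∃ q, IsReturn x (i + D) q (b (k + 1)) ∧ s = i + q)
      (fun i ⟨q, hqM, hq, hiq⟩ => ⟨i + q, hiq, by omega, by omega, q, hq, rfl⟩)
      (fun i i' s ⟨q, hq, hs⟩ ⟨q', hq', hs'⟩ => by
        have := hq.start_unique hq' (by omega)
        omega)
  -- The exceptional sets cost `δ / 8 + δ / 8 + δ / 4`, leaving `δ / 2` for `S k`.
  have hcover : ∀ k < r, E ⊆ ((R k ∪ R (k + 1)) ∪ T k) ∪ S k := by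
    intro k hk i hi
    by_contra hnot
    simp only [Set.mem_union, not_or] at hnot
    obtain ⟨⟨⟨h1, h2⟩, h3⟩, h4⟩ := hnot
    obtain ⟨q₀, hq₀, hq₀M, hag₀⟩ := exists_agree_of_notMem_noReturn h2
    obtain ⟨q, hqq, hq⟩ := exists_isReturn hq₀ hag₀
    have hUq : i + q ∉ U := fun h => h3 ⟨q, by omega, hq, h⟩
    have h5 := exists_notMem_of_matching (M := fun k => M (b k))
      (fun l => (le_max_right _ _).trans (hb0 l)) hbm hbM hk hi h1 hq
      (fun l hl h => hUq ⟨l, hl, h⟩)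
    have h6 : (fun t : Fin D => x (i + q + t)) ∈ F i (k + 1) := ⟨k + 1, le_rfl, q, hq, rfl⟩
    have h7 : F i k = F i (k + 1) := not_not.1 h4
    rw [← h7] at h6
    obtain ⟨l, hl, q', hq', heq⟩ := h6
    exact h5 l hl q' hq' fun t ht => congrFun heq ⟨t, ht⟩
  have hk : ∀ k ∈ Finset.range r, δ / 2 ≤ density a (S k) := by
    intro k hk
    have h1 := density_mono (a := a) (hcover k (Finset.mem_range.1 hk))
    have h2 := density_union_le (a := a) ((R k ∪ R (k + 1)) ∪ T k) (S k)
    have h3 := density_union_le (a := a) (R k ∪ R (k + 1)) (T k)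
    have h4 := density_union_le (a := a) (R k) (R (k + 1))
    linarith [hR k, hR (k + 1), hT k]
  have h1 := Finset.card_nsmul_le_sum _ _ _ hk
  rw [Finset.card_range, nsmul_eq_mul] at h1
  have h2 : (0 : ℝ) < r * δ := by positivity
  linarith

/-- The short return at `s` lies inside the second occurrence of the `β'`-factor. Translated back by
`q₀`, it ends where the first occurrence ends, and there `hr` makes the right contexts match. -/
theorem hasWideReturn_of_right_match {D β β' M B i q₀ : ℕ} {l : ℕ} {b : ℕ → ℕ}
    (hB : B ≤ b l) (hbl : b l ≤ β) (hββ : β + M + 2 * D ≤ β')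
    (hq₀ : IsReturn x (i + D) q₀ β')
    (hR : i + D + β' - β ∉ noPriorReturn x β M)
    {s q : ℕ} (he : s + D + b l + q = i + D + β' + q₀) (hDq : D < q)
    (hq : IsReturn x (s + D) q (b l)) (hl : Agree x s (s + q) D)
    (hr : Agree x (i + D + β') (s + D + b l) D) : HasWideReturn x D B := by
  obtain ⟨q', hq', hq'M, hag'⟩ := exists_agree_of_notMem_noPriorReturn hR (by omega)
  have hag := hq₀.2.1
  -- The prior occurrence within `M` bounds `q`, which places the short return inside the long
  -- factor.
  have hqq : q ≤ q' := by
    by_contra! hcon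
    refine hq.2.2 (q - q') (by omega) (by omega) (hq.2.1.trans ?_)
    have h1 : Agree x (i + D + β' - b l) (i + D + β' - b l - q') (b l) :=
      hag'.symm.shift (β - b l) (by omega) (by omega) (by omega)
    have h2 : Agree x (s + D + q) (i + D + β' - b l) (b l) :=
      hag.symm.shift (β' - b l) (by omega) (by omega) (by omega)
    have h3 : Agree x (i + D + β' - b l - q') (s + D + (q - q')) (b l) :=
      hag.shift (β' - b l - q') (by omega) (by omega) (by omega)
    exact (h2.trans h1).trans h3
  have hs : q₀ ≤ s := by omega
  have h1 : Agree x s (s - q₀) (D + b l + q) :=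
    hag.symm.shift (s - q₀ - (i + D)) (by omega) (by omega) (by omega)
  have h2 : IsReturn x (s - q₀ + D) q (b l) :=
    hq.transfer (n := b l + q) (h1.shift D rfl rfl (by omega)) (by omega)
  refine ⟨s - q₀, q, b l, hDq, hB, h2, ?_⟩
  intro t ht
  rcases Nat.lt_or_ge t D with h3 | h3
  · have h4 : Agree x (s - q₀) (s - q₀ + q) D :=
      ((h1.symm.mono (by omega)).trans hl).trans (h1.shift q rfl rfl (by omega))
    exact h4 t h3
  · rcases Nat.lt_or_ge t (D + b l) with h5 | h5
    · exact h2.2.1.apply (by omega) (by omega) (by omega)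
    · have h6 : x (s - q₀ + q + t) = x (s + t) := hr.apply (by omega) (by omega) (by omega)
      rw [h6]
      exact h1.symm.apply (by omega) (by omega) (by omega)

theorem hasWideReturn_of_density_pos [Finite A] {D w : ℕ}
    (hδ : 0 < density a (shiftedNonperiodic x D w)) : HasWideReturn x D w := by
  classical
  obtain ⟨c, hc, hb⟩ := exists_density_leftMatched_ge hδ
  choose next hnext hdens using hb
  choose M hM hM' using fun b => exists_density_noReturn_le x a b (show 0 < c / 4 by positivity)
  by_contra hno
  set E := shiftedNonperiodic x D w with hE
  let b : ℕ → ℕ := fun t => Nat.rec w (fun _ b => next (b + M b + 2 * D)) t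
  have hbM : ∀ t, b t + M (b t) + 2 * D ≤ b (t + 1) := fun t => hnext _
  have hdens' : ∀ t, c ≤ density a (E ∩ leftMatched x D (b (t + 1))) := fun t => hdens _
  have hbm : Monotone b := monotone_nat_of_le_succ fun k => by have := hbM k; omega
  have hb0 : ∀ t, w ≤ b t := fun t => hbm (Nat.zero_le t)
  -- For left matched returns whose second occurrence ends at `e`, the `D` letters following the
  -- first occurrence. Without a wide return, each point of `P t` yields an end `e` with a new
  -- context.
  let F : ℕ → ℕ → Set (Fin D → A) := fun e t =>
    {v | ∃ l ≤ t, ∃ q s, s + D + b l + q = e ∧ D < q ∧ IsReturn x (s + D) q (b l) ∧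
      Agree x s (s + q) D ∧ v = fun u : Fin D => x (s + D + b l + u)}
  have hF : ∀ e, Monotone (F e) := fun e k k' hk z ⟨l, hl, h⟩ => ⟨l, hl.trans hk, h⟩
  let S : ℕ → Set ℕ := fun t => {e | F e t ≠ F e (t + 1)}
  let P : ℕ → Set ℕ := fun t => {i | i ∈ E ∧
    (∃ q ≤ M (b (t + 1)), IsReturn x (i + D) q (b (t + 1)) ∧ Agree x i (i + q) D) ∧
    i + (D + b (t + 1) - b t) ∉ noPriorReturn x (b t) (M (b t))}
  have hP : ∀ t, c / 2 ≤ density a (P t) := by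
    intro t
    let R₁ : Set ℕ := {i | i + D ∈ noReturn x (b (t + 1)) (M (b (t + 1)))}
    let R₂ : Set ℕ :=
      {i | i + (D + b (t + 1) - b t) ∈ noPriorReturn x (b t) (M (b t))}
    have hsub : E ∩ leftMatched x D (b (t + 1)) ⊆ (R₁ ∪ R₂) ∪ P t := by
      rintro i ⟨hi, q, hq, hag⟩
      by_contra hnot
      simp only [Set.mem_union, not_or] at hnot
      obtain ⟨⟨h1, h2⟩, h3⟩ := hnot
      obtain ⟨q₀, hq₀, hq₀M, hag₀⟩ := exists_agree_of_notMem_noReturn h1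
      exact h3 ⟨hi, ⟨q, (hq.le_of_agree hq₀ hag₀ le_rfl).trans hq₀M, hq, hag⟩, h2⟩
    have h1 := density_mono (a := a) hsub
    have h2 := density_union_le (a := a) (R₁ ∪ R₂) (P t)
    have h3 := density_union_le (a := a) R₁ R₂
    have h4 : density a R₁ ≤ c / 4 := (density_shift_le _ _).trans (hM _)
    have h5 : density a R₂ ≤ c / 4 := (density_shift_le _ _).trans (hM' _)
    linarith [hdens' t]
  have hPS : ∀ t, density a (P t) ≤ density a (S t) := by
    intro t
    refine density_le_of_matching (M := D + b (t + 1) + M (b (t + 1)))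
      (fun i s => ∃ q, IsReturn x (i + D) q (b (t + 1)) ∧ s = i + D + b (t + 1) + q) ?_ ?_
    · rintro i ⟨hi, ⟨q₀, hq₀M, hq₀, hag⟩, hR⟩
      refine ⟨i + D + b (t + 1) + q₀, fun heq => hno ?_, by omega, by omega, q₀, hq₀, rfl⟩
      have h1 : (fun u : Fin D => x (i + D + b (t + 1) + u)) ∈
          F (i + D + b (t + 1) + q₀) (t + 1) :=
        ⟨t + 1, le_rfl, q₀, i, rfl, hq₀.lt_of_mem hi (hb0 (t + 1)), hq₀, hag, rfl⟩
      rw [← heq] at h1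
      obtain ⟨l, hl, q, s, he, hDq, hq, hls, hv⟩ := h1
      have h2 := hbM t
      rw [show i + (D + b (t + 1) - b t) = i + D + b (t + 1) - b t by omega] at hR
      exact hasWideReturn_of_right_match (hb0 l) (hbm hl) h2 hq₀ hR he hDq hq hls
        fun u hu => congrFun hv ⟨u, hu⟩
    · rintro i i' s ⟨q, hq, hs⟩ ⟨q', hq', hs'⟩
      have := hq.start_unique hq' (by omega)
      omega
  obtain ⟨T, hT⟩ := exists_nat_gt (2 * Nat.card (Fin D → A) / c)
  rw [div_lt_iff₀ hc] at hT
  have hS : ∑ t ∈ Finset.range T, density a (S t) ≤ Nat.card (Fin D → A) :=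
    sum_density_le fun e => by
      convert card_filter_ne_succ_le (hF e) T
  have h1 := Finset.card_nsmul_le_sum (Finset.range T) (fun t => density a (S t)) (c / 2)
    fun t _ => (hP t).trans (hPS t)
  rw [Finset.card_range, nsmul_eq_mul] at h1
  linarith

theorem hasWideReturn_of_aperiodic [Finite A] (hx : Aperiodic x) (D B : ℕ) :
    HasWideReturn x D B := by
  suffices h : HasWideReturn x D (max B (2 * D + 1)) by
    obtain ⟨i, q, b, h1, h2, h3⟩ := h
    exact ⟨i, q, b, h1, (le_max_left _ _).trans h2, h3⟩
  by_cases hL : ∃ L, ∀ i j,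
      IsChain (nonperiodicPositions x D (max B (2 * D + 1))) (D + 1) i j → j < i + L
  · obtain ⟨L, hL⟩ := hL
    exact hasWideReturn_of_bounded_chains hx (le_max_right _ _) hL
  · push Not at hL
    -- The extra `D` absorbs the shift in `shiftedNonperiodic`, so the chain covers all of `[a k, a
    -- k + k]` after shifting.
    choose a c hchain hac using fun k => hL (k + 1 + D)
    refine hasWideReturn_of_density_pos (a := a) ?_
    have h1 := one_le_mul_density (a := a) (G := D + 1)
      (E := shiftedNonperiodic x D (max B (2 * D + 1))) fun k j hj hj' => by
        have h2 := hac k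
        obtain ⟨e, heE, h3, h4⟩ := (hchain k).2.2.2 (j + D) (by omega) (by omega)
        refine ⟨e - D, ?_, by omega, by omega⟩
        unfold shiftedNonperiodic
        rwa [Set.mem_ofPred_eq, Nat.sub_add_cancel (by omega)]
    by_contra! hcon
    have h2 : ((D + 1 : ℕ) : ℝ) *
        density a (shiftedNonperiodic x D (max B (2 * D + 1))) ≤ 0 :=
      mul_nonpos_of_nonneg_of_nonpos (by positivity) hcon
    linarith

end InfWord

theorem theorem1 {A : Type*} [Finite A] (x : ℕ → A) :
    List.TFAE [
      InfWord.Aperiodic x,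
      Filter.liminf (fun n : ℕ => InfWord.openComplexity x n) Filter.atTop = (⊤ : ℕ∞),
      Filter.limsup (fun n : ℕ => InfWord.closedComplexity x n) Filter.atTop = (⊤ : ℕ∞),
      ∀ S : Set ℕ, InfWord.Syndetic S →
        Filter.limsup (fun n : ℕ => InfWord.closedComplexity x n)
          (Filter.atTop ⊓ Filter.principal S) = (⊤ : ℕ∞)] := by
  tfae_have 1 → 2 := InfWord.liminf_openComplexity_eq_top
  tfae_have 1 → 4 := fun hx S hS =>
    InfWord.limsup_closedComplexity_eq_top (InfWord.hasWideReturn_of_aperiodic hx) hS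
  tfae_have 4 → 3 := by
    intro h
    have h1 := h Set.univ ⟨1, one_pos, fun n => ⟨n, Set.mem_univ _, le_rfl, Nat.le_succ n⟩⟩
    rwa [Filter.principal_univ, inf_top_eq] at h1
  tfae_have 2 → 1 := by
    intro h hper
    obtain ⟨C, hC⟩ := InfWord.encard_factor_le hper
    have h1 : Filter.liminf (fun n : ℕ => InfWord.openComplexity x n) Filter.atTop ≤ (C : ℕ∞) :=
      Filter.liminf_le_of_frequently_le (Filter.Frequently.of_forall fun n => hC n _)
        (by isBoundedDefault)
    rw [h] at h1
    exact absurd h1 (by simp)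
  tfae_have 3 → 1 := by
    intro h hper
    obtain ⟨C, hC⟩ := InfWord.encard_factor_le hper
    have h1 : Filter.limsup (fun n : ℕ => InfWord.closedComplexity x n) Filter.atTop ≤ (C : ℕ∞) :=
      Filter.limsup_le_of_le (by isBoundedDefault) (Filter.Eventually.of_forall fun n => hC n _)
    rw [h] at h1
    exact absurd h1 (by simp)
  tfae_finish
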